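/- Let $\tau f(t) = -\tfrac12 f''(t) + \tfrac12 t^2 f(t)$, $\mathbb R_+=(0,\infty)$ and $\mathbb R_-=(-\infty,0)$. For $\theta\in[0,\pi)$ let $A_{\pm,\theta}$ be the operator in $L_2(\mathbb R_\pm)$ (complex-valued functions) acting as $f\mapsto\tau f$ on the domain of all $f\in L_2(\mathbb R_\pm)$ such that $f$ and $f'$ are absolutely continuous on compact subintervals of $\mathbb R_\pm$, $\tau f\in L_2(\mathbb R_\pm)$, and $$\cos(\theta)\, f(\pm0) = \sin(\theta)\, f'(\pm0),$$ where $f(\pm0)$ and $f'(\pm0)$ are the one-sided limits at $0$ from within $\mathbb R_\pm$. For $\omega\ge 0$ let $u(\cdot,\omega)$ be the solution on $[0,\infty)$ of $-\tfrac12 u''+\tfrac12t^2u=-\omega^2u$, $u(0,\omega)=1$, $u'(0,\omega)=0$, let $G(\omega)=\int_0^\infty u(s,\omega)^{-2}\,ds$, and let $\alpha_A=\arctan(G(0))$. 1. For $\theta\in[0,\pi)$, $A_{+,\theta}$ has the eigenvalue $0$ if and only if $\theta=\pi-\alpha_A$, and it has a negative eigenvalue if and only if $\theta\in(\pi-\alpha_A,\pi)$.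 Moreover, if $\theta_1,\theta_2\in[0,\pi)$, $\lambda_j$ is an eigenvalue of $A_{+,\theta_j}$ for $j=1,2$, and $\lambda_2<\lambda_1<0$, then $\pi-\alpha_A<\theta_1<\theta_2<\pi$. 2. For $\theta\in[0,\pi)$, $A_{-,\theta}$ has the eigenvalue $0$ if and only if $\theta=\alpha_A$, and it has a negative eigenvalue if and only if $\theta\in(0,\alpha_A)$. Moreover, if $\theta_1,\theta_2\in[0,\pi)$, $\lambda_j$ is an eigenvalue of $A_{-,\theta_j}$ for $j=1,2$, and $\lambda_2<\lambda_1<0$, then $\alpha_A>\theta_1>\theta_2>0$. -/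

import Mathlib

open MeasureTheory Filter Topology Set

/-! ### The harmonic oscillator on a half-line -/

/-- The formal differential expression `(τ f)(t) = (-(1/2) d²/dt² + (1/2) t²) f(t)`. -/
noncomputable def oscExpr (f : ℝ → ℂ) (t : ℝ) : ℂ :=
  -(1 / 2 : ℂ) * deriv (deriv f) t + (1 / 2 : ℂ) * (t : ℂ) ^ 2 * f t

/-- Absolute continuity on every compact interval contained in `I`. -/
def LocAbsCont (f : ℝ → ℂ) (I : Set ℝ) : Prop :=
  ∀ a b : ℝ, uIcc a b ⊆ I → AbsolutelyContinuousOnInterval f a b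

/-- Membership of a function on the open interval `I` in the domain of the maximal operator:
`f` and its derivative `f'` are locally absolutely continuous on `I`,
and both `f` and `τ f` lie in `L²(I)`.
The values of `f` outside `I` play no role. -/
structure InMaxDomain (I : Set ℝ) (f : ℝ → ℂ) : Prop where
  differentiableOn : DifferentiableOn ℝ f I
  absCont : LocAbsCont f I
  absCont_deriv : LocAbsCont (deriv f) I
  memLp : MemLp f 2 (volume.restrict I)
  memLp_oscExpr : MemLp (oscExpr f) 2 (volume.restrict I)

/-- The boundary condition `cos θ · f(0) = sin θ · f'(0)` in terms of the limits of `f` and `f'`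
at `0` from inside `I`: the limits at `+0` for `I = (0, ∞)`, at `-0` for `I = (-∞, 0)`. -/
def BoundaryCond (I : Set ℝ) (θ : ℝ) (f : ℝ → ℂ) : Prop :=
  ∃ a b : ℂ, Tendsto f (𝓝[I] 0) (𝓝 a) ∧ Tendsto (deriv f) (𝓝[I] 0) (𝓝 b) ∧
    (Real.cos θ : ℂ) * a = (Real.sin θ : ℂ) * b

/-- The Hilbert space `L²(I)` of complex-valued functions. -/
abbrev L2 (I : Set ℝ) : Type := Lp ℂ 2 (volume.restrict I)

theorem LocAbsCont.ae_differentiableAt {f : ℝ → ℂ} {I : Set ℝ} (h : LocAbsCont f I)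
    (hI : IsOpen I) (hc : I.OrdConnected) :
    ∀ᵐ t ∂(volume.restrict I), DifferentiableAt ℝ f t := by
  have hb : LocallyBoundedVariationOn f I := by
    intro a b ha hb
    rcases le_total a b with hab | hab
    · have := (h a b (hc.uIcc_subset ha hb)).boundedVariationOn
      rw [uIcc_of_le hab] at this
      exact this.mono inter_subset_right
    · refine (eVariationOn.subsingleton f ?_).trans_ne ENNReal.zero_ne_top
      intro x hx y hy
      linarith [hx.2.1, hx.2.2, hy.2.1, hy.2.2]
  have := hb.ae_differentiableWithinAt_of_mem
  rw [ae_restrict_iff' hI.measurableSet]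
  filter_upwards [this] with t ht htI
  exact (ht htI).differentiableAt (hI.mem_nhds htI)

theorem eqOn_deriv_of_eqOn {f g : ℝ → ℂ} {I : Set ℝ} (hI : IsOpen I) (h : EqOn f g I) :
    EqOn (deriv f) (deriv g) I := fun _ ht =>
  (h.eventuallyEq_of_mem (hI.mem_nhds ht)).deriv_eq

theorem oscExpr_eqOn {f g : ℝ → ℂ} {I : Set ℝ} (hI : IsOpen I) (h : EqOn f g I) :
    EqOn (oscExpr f) (oscExpr g) I := by
  intro t ht
  simp only [oscExpr, h ht, eqOn_deriv_of_eqOn hI (eqOn_deriv_of_eqOn hI h) ht]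

theorem InMaxDomain.deriv_add {I : Set ℝ} (hI : IsOpen I) {f g : ℝ → ℂ} (hf : InMaxDomain I f)
    (hg : InMaxDomain I g) : EqOn (deriv (f + g)) (deriv f + deriv g) I := fun _ ht =>
  _root_.deriv_add (hf.differentiableOn.differentiableAt (hI.mem_nhds ht))
    (hg.differentiableOn.differentiableAt (hI.mem_nhds ht))

theorem InMaxDomain.oscExpr_add {I : Set ℝ} (hI : IsOpen I) (hc : I.OrdConnected) {f g : ℝ → ℂ}
    (hf : InMaxDomain I f) (hg : InMaxDomain I g) :
    oscExpr (f + g) =ᵐ[volume.restrict I] oscExpr f + oscExpr g := by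
  filter_upwards [hf.absCont_deriv.ae_differentiableAt hI hc,
    hg.absCont_deriv.ae_differentiableAt hI hc, ae_restrict_mem hI.measurableSet] with t h1 h2 ht
  have := eqOn_deriv_of_eqOn hI (hf.deriv_add hI hg) ht
  simp only [oscExpr, Pi.add_apply, this, _root_.deriv_add h1 h2]
  ring

theorem deriv_smul_fun (c : ℂ) (f : ℝ → ℂ) : deriv (c • f) = c • deriv f := by
  ext t
  exact deriv_const_smul_field c f

theorem oscExpr_smul (c : ℂ) (f : ℝ → ℂ) : oscExpr (c • f) = c • oscExpr f := by
  ext t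
  simp only [oscExpr, deriv_smul_fun, Pi.smul_apply, smul_eq_mul]
  ring

theorem LocAbsCont.congr {f g : ℝ → ℂ} {I : Set ℝ} (hf : LocAbsCont f I) (h : EqOn f g I) :
    LocAbsCont g I := by
  intro a b hab
  have := hf a b hab
  rw [absolutelyContinuousOnInterval_iff] at this ⊢
  intro ε hε
  obtain ⟨δ, hδ, H⟩ := this ε hε
  refine ⟨δ, hδ, fun E hE hlt => ?_⟩
  convert H E hE hlt using 1
  refine Finset.sum_congr rfl fun i hi => ?_
  have := hE.1 i hi
  rw [h (hab this.1), h (hab this.2)]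

theorem InMaxDomain.add {I : Set ℝ} (hI : IsOpen I) (hc : I.OrdConnected) {f g : ℝ → ℂ}
    (hf : InMaxDomain I f) (hg : InMaxDomain I g) : InMaxDomain I (f + g) where
  differentiableOn := hf.differentiableOn.add hg.differentiableOn
  absCont := fun a b h => (hf.absCont a b h).add (hg.absCont a b h)
  absCont_deriv := LocAbsCont.congr
    (fun a b h => (hf.absCont_deriv a b h).add (hg.absCont_deriv a b h))
    (hf.deriv_add hI hg).symm
  memLp := hf.memLp.add hg.memLp
  memLp_oscExpr := (hf.memLp_oscExpr.add hg.memLp_oscExpr).ae_eq (hf.oscExpr_add hI hc hg).symm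

theorem InMaxDomain.smul {I : Set ℝ} {f : ℝ → ℂ} (c : ℂ) (hf : InMaxDomain I f) :
    InMaxDomain I (c • f) where
  differentiableOn := hf.differentiableOn.const_smul c
  absCont := fun a b h => (hf.absCont a b h).const_smul c
  absCont_deriv := by
    rw [deriv_smul_fun]
    exact fun a b h => (hf.absCont_deriv a b h).const_smul c
  memLp := hf.memLp.const_smul c
  memLp_oscExpr := by
    rw [oscExpr_smul]
    exact hf.memLp_oscExpr.const_smul c

theorem InMaxDomain.zero (I : Set ℝ) : InMaxDomain I 0 := by
  have h0 : deriv (0 : ℝ → ℂ) = 0 := by ext t; simp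
  have h1 : oscExpr (0 : ℝ → ℂ) = 0 := by ext t; simp [oscExpr, h0]
  have h2 : LocAbsCont (0 : ℝ → ℂ) I := fun a b _ =>
    ((LipschitzWith.const (0 : ℂ)).lipschitzOnWith).absolutelyContinuousOnInterval
  refine ⟨differentiableOn_const 0, h2, ?_, MemLp.zero', ?_⟩
  · rw [h0]; exact h2
  · rw [h1]; exact MemLp.zero'

/-- The graph, in `L²(I) × L²(I)`, of the restriction of the maximal operator `f ↦ τ f` on `I`
to the functions that satisfy the boundary condition with parameter `θ`. -/
noncomputable def oscGraph (I : Set ℝ) (hI : IsOpen I) (hc : I.OrdConnected) (θ : ℝ) :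
    Submodule ℂ (L2 I × L2 I) where
  carrier := {p | ∃ f : ℝ → ℂ, InMaxDomain I f ∧ BoundaryCond I θ f ∧
    p.1 =ᵐ[volume.restrict I] f ∧ p.2 =ᵐ[volume.restrict I] oscExpr f}
  add_mem' := by
    rintro p q ⟨f, hf, ⟨a, b, ha, hb, hab⟩, hp1, hp2⟩ ⟨g, hg, ⟨a', b', ha', hb', hab'⟩, hq1, hq2⟩
    refine ⟨f + g, hf.add hI hc hg, ⟨a + a', b + b', ha.add ha', ?_, ?_⟩, ?_, ?_⟩
    · refine (hb.add hb').congr' ?_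
      filter_upwards [self_mem_nhdsWithin] with t ht
      exact (hf.deriv_add hI hg ht).symm
    · rw [mul_add, mul_add, hab, hab']
    · exact (Lp.coeFn_add _ _).trans (hp1.add hq1)
    · exact (Lp.coeFn_add _ _).trans ((hp2.add hq2).trans (hf.oscExpr_add hI hc hg).symm)
  zero_mem' := by
    have h0 : deriv (0 : ℝ → ℂ) = 0 := by ext t; simp
    have h1 : oscExpr (0 : ℝ → ℂ) = 0 := by ext t; simp [oscExpr, h0]
    refine ⟨0, InMaxDomain.zero I, ⟨0, 0, tendsto_const_nhds, ?_, by simp⟩,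
      Lp.coeFn_zero _ _ _, ?_⟩
    · rw [h0]; exact tendsto_const_nhds
    · rw [h1]; exact Lp.coeFn_zero _ _ _
  smul_mem' := by
    rintro c p ⟨f, hf, ⟨a, b, ha, hb, hab⟩, hp1, hp2⟩
    refine ⟨c • f, hf.smul c, ⟨c • a, c • b, ha.const_smul c, ?_, ?_⟩, ?_, ?_⟩
    · rw [deriv_smul_fun]; exact hb.const_smul c
    · simp only [smul_eq_mul]; linear_combination c * hab
    · exact (Lp.coeFn_smul _ _).trans (hp1.const_smul c)
    · rw [oscExpr_smul]; exact (Lp.coeFn_smul _ _).trans (hp2.const_smul c)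

/-- The graph is single-valued, so that it is the graph of an operator. -/
theorem oscGraph_single_valued (I : Set ℝ) (hI : IsOpen I) (hc : I.OrdConnected) (θ : ℝ) :
    ∀ p : L2 I × L2 I, p ∈ oscGraph I hI hc θ → p.1 = 0 → p.2 = 0 := by
  rintro p ⟨f, hf, -, hp1, hp2⟩ h0
  rw [h0] at hp1
  have hz : f =ᵐ[volume.restrict I] (fun _ => (0 : ℂ)) :=
    hp1.symm.trans (Lp.coeFn_zero _ _ _)
  have hz' : EqOn f (fun _ => (0 : ℂ)) I :=
    Measure.eqOn_open_of_ae_eq hz hI hf.differentiableOn.continuousOn continuousOn_const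
  have h1 := oscExpr_eqOn hI hz'
  rw [Lp.eq_zero_iff_ae_eq_zero]
  refine hp2.trans ?_
  filter_upwards [ae_restrict_mem hI.measurableSet] with t ht
  rw [h1 ht]
  simp [oscExpr]

/-- The unbounded operator in `L²(I)` acting as `f ↦ τ f` on those `f` in the maximal domain
with `cos θ · f(0) = sin θ · f'(0)`. -/
noncomputable def oscOp (I : Set ℝ) (hI : IsOpen I) (hc : I.OrdConnected) (θ : ℝ) :
    L2 I →ₗ.[ℂ] L2 I :=
  (oscGraph I hI hc θ).toLinearPMap

theorem graph_oscOp (I : Set ℝ) (hI : IsOpen I) (hc : I.OrdConnected) (θ : ℝ) :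
    (oscOp I hI hc θ).graph = oscGraph I hI hc θ :=
  Submodule.toLinearPMap_graph_eq _ (oscGraph_single_valued I hI hc θ)

/-- The operator `A_{+,θ}` in `L²(0, ∞)`. -/
noncomputable def oscPlus (θ : ℝ) : L2 (Ioi 0) →ₗ.[ℂ] L2 (Ioi 0) :=
  oscOp (Ioi 0) isOpen_Ioi ordConnected_Ioi θ

/-- The operator `A_{-,θ}` in `L²(-∞, 0)`. -/
noncomputable def oscMinus (θ : ℝ) : L2 (Iio 0) →ₗ.[ℂ] L2 (Iio 0) :=
  oscOp (Iio 0) isOpen_Iio ordConnected_Iio θ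

/-- `μ` is an eigenvalue of the unbounded operator `T`. -/
def IsEigenvalue {E : Type*} [AddCommGroup E] [Module ℂ E] (T : E →ₗ.[ℂ] E) (μ : ℂ) : Prop :=
  ∃ x : T.domain, (x : E) ≠ 0 ∧ T x = μ • (x : E)

/-- Reformulation of the eigenvalue condition in terms of functions. -/
theorem isEigenvalue_oscOp_iff (I : Set ℝ) (hI : IsOpen I) (hc : I.OrdConnected) (θ : ℝ)
    (μ : ℂ) : IsEigenvalue (oscOp I hI hc θ) μ ↔
      ∃ f : ℝ → ℂ, InMaxDomain I f ∧ BoundaryCond I θ f ∧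
        ¬ f =ᵐ[volume.restrict I] 0 ∧ oscExpr f =ᵐ[volume.restrict I] μ • f := by
  have key : IsEigenvalue (oscOp I hI hc θ) μ ↔
      ∃ x : L2 I, x ≠ 0 ∧ (x, μ • x) ∈ oscGraph I hI hc θ := by
    rw [← graph_oscOp]
    constructor
    · rintro ⟨x, hx, h⟩
      exact ⟨x, hx, h ▸ LinearPMap.mem_graph _ x⟩
    · rintro ⟨x, hx, h⟩
      rw [LinearPMap.mem_graph_iff] at h
      obtain ⟨y, hy, hy'⟩ := h
      simp only at hy hy'
      exact ⟨y, hy ▸ hx, by rw [hy', hy]⟩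
  rw [key]
  constructor
  · rintro ⟨x, hx, f, hf, hb, h1, h2⟩
    refine ⟨f, hf, hb, fun h => hx ?_, ?_⟩
    · rw [Lp.eq_zero_iff_ae_eq_zero]; exact h1.trans h
    · exact h2.symm.trans ((Lp.coeFn_smul _ _).trans (h1.const_smul μ))
  · rintro ⟨f, hf, hb, h0, h1⟩
    have hx := hf.memLp.coeFn_toLp
    refine ⟨hf.memLp.toLp f, fun h => h0 ?_, f, hf, hb, hx, ?_⟩
    · rw [Lp.eq_zero_iff_ae_eq_zero] at h; exact hx.symm.trans h
    · exact (Lp.coeFn_smul _ _).trans ((hx.const_smul μ).trans h1.symm)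

/-! ### The function `G` and the angle `α_A` -/

/-- `u` solves, on `[0, ∞)`, the Cauchy problem
`-(1/2) u'' + (1/2) t² u = -ω² u`, `u(0) = 1`, `u'(0) = 0`. -/
def IsCauchySolution (ω : ℝ) (u : ℝ → ℝ) : Prop :=
  u 0 = 1 ∧ ∃ u' u'' : ℝ → ℝ, u' 0 = 0 ∧
    ∀ t ∈ Ici (0 : ℝ), HasDerivWithinAt u (u' t) (Ici 0) t ∧
      HasDerivWithinAt u' (u'' t) (Ici 0) t ∧
      -(1 / 2) * u'' t + (1 / 2) * t ^ 2 * u t = -ω ^ 2 * u t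

/-- The Taylor coefficients at `0` of the solution of the Cauchy problem. -/
noncomputable def cauchyCoeff (ω : ℝ) : ℕ → ℝ
  | 0 => 1
  | 1 => 0
  | 2 => ω ^ 2
  | 3 => 0
  | n + 4 => (2 * ω ^ 2 * cauchyCoeff ω (n + 2) + cauchyCoeff ω n) / ((n + 4) * (n + 3))

/-- The solution of the Cauchy problem, as the sum of its power series. -/
noncomputable def cauchySol (ω t : ℝ) : ℝ := ∑' n : ℕ, cauchyCoeff ω n * t ^ n

theorem cauchyCoeff_bound (ω r : ℝ) (hr : 0 < r) :
    ∃ K : ℝ, ∀ n, |cauchyCoeff ω n| ≤ K * r ^ n := by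
  obtain ⟨N, hN⟩ := exists_nat_ge ((2 * ω ^ 2 * r ^ 2 + 1) / r ^ 4)
  have hN' : 2 * ω ^ 2 * r ^ 2 + 1 ≤ N * r ^ 4 := by
    rwa [div_le_iff₀ (by positivity)] at hN
  let K : ℝ := ∑ i ∈ Finset.range (N + 4), |cauchyCoeff ω i| / r ^ i
  have hK : 0 ≤ K := Finset.sum_nonneg fun i _ => by positivity
  refine ⟨K, fun n => ?_⟩
  induction n using Nat.strong_induction_on with
  | _ n ih =>
    by_cases hn : n < N + 4
    · rw [← div_le_iff₀ (by positivity)]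
      exact Finset.single_le_sum (f := fun i => |cauchyCoeff ω i| / r ^ i)
        (fun i _ => by positivity) (Finset.mem_range.2 hn)
    · obtain ⟨m, rfl⟩ : ∃ m, n = m + 4 := ⟨n - 4, by omega⟩
      have hm : (N : ℝ) ≤ m := by exact_mod_cast (by omega : N ≤ m)
      have h1 := ih m (by omega)
      have h2 := ih (m + 2) (by omega)
      have hm0 : (0 : ℝ) ≤ m := Nat.cast_nonneg m
      rw [cauchyCoeff, abs_div, abs_of_pos (by positivity : (0 : ℝ) < (m + 4) * (m + 3)),
        div_le_iff₀ (by positivity)]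
      have h3 : 2 * ω ^ 2 * r ^ 2 + 1 ≤ r ^ 4 * ((m + 4) * (m + 3)) := by
        refine hN'.trans ?_
        have hr4 : 0 < r ^ 4 := by positivity
        nlinarith [mul_le_mul_of_nonneg_left hm hr4.le, mul_nonneg hr4.le hm0,
          mul_nonneg hr4.le (mul_nonneg hm0 hm0)]
      calc |2 * ω ^ 2 * cauchyCoeff ω (m + 2) + cauchyCoeff ω m|
          ≤ |2 * ω ^ 2 * cauchyCoeff ω (m + 2)| + |cauchyCoeff ω m| := abs_add_le _ _
        _ = 2 * ω ^ 2 * |cauchyCoeff ω (m + 2)| + |cauchyCoeff ω m| := by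
            rw [abs_mul, abs_of_nonneg (by positivity : 0 ≤ 2 * ω ^ 2)]
        _ ≤ 2 * ω ^ 2 * (K * r ^ (m + 2)) + K * r ^ m := by gcongr
        _ = K * r ^ m * (2 * ω ^ 2 * r ^ 2 + 1) := by ring
        _ ≤ K * r ^ m * (r ^ 4 * ((m + 4) * (m + 3))) := by gcongr
        _ = K * r ^ (m + 4) * ((m + 4) * (m + 3)) := by ring

/-- A power series whose coefficients decay faster than every geometric sequence may be
differentiated term by term, and the derived coefficients decay in the same way. -/
theorem hasDerivAt_entire_series (a : ℕ → ℝ)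
    (ha : ∀ r : ℝ, 0 < r → ∃ K : ℝ, ∀ n, |a n| ≤ K * r ^ n) :
    (∀ t : ℝ, HasDerivAt (fun x => ∑' n : ℕ, a n * x ^ n)
      (∑' n : ℕ, ((n + 1 : ℝ) * a (n + 1)) * t ^ n) t) ∧
    (∀ r : ℝ, 0 < r → ∃ K : ℝ, ∀ n : ℕ, |(n + 1 : ℝ) * a (n + 1)| ≤ K * r ^ n) ∧
    (∀ t : ℝ, Summable fun n : ℕ => a n * t ^ n) := by
  have hpow : ∀ n : ℕ, (n : ℝ) + 1 ≤ 2 ^ n := fun n => by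
    exact_mod_cast Nat.lt_two_pow_self (n := n)
  have hb : ∀ r : ℝ, 0 < r → ∃ K : ℝ, ∀ n : ℕ, |(n + 1 : ℝ) * a (n + 1)| ≤ K * r ^ n := by
    intro r hr
    obtain ⟨K, hK⟩ := ha (r / 2) (by positivity)
    have hK0 : 0 ≤ K := by simpa using (abs_nonneg _).trans (hK 0)
    refine ⟨K * (r / 2), fun n => ?_⟩
    rw [abs_mul, abs_of_pos (by positivity : (0 : ℝ) < n + 1)]
    calc (n + 1 : ℝ) * |a (n + 1)| ≤ 2 ^ n * (K * (r / 2) ^ (n + 1)) :=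
          mul_le_mul (hpow n) (hK _) (abs_nonneg _) (by positivity)
      _ = K * (r / 2) * r ^ n := by
          rw [pow_succ, div_pow]; field_simp
  have hs : ∀ b : ℕ → ℝ, (∀ r : ℝ, 0 < r → ∃ K : ℝ, ∀ n, |b n| ≤ K * r ^ n) →
      ∀ R : ℝ, 0 < R → Summable fun n : ℕ => |b n| * R ^ n := by
    intro b hb R hR
    obtain ⟨K, hK⟩ := hb (1 / (2 * R)) (by positivity)
    refine Summable.of_nonneg_of_le (fun n => by positivity) (fun n => ?_)
      ((summable_geometric_two).mul_left K)
    calc |b n| * R ^ n ≤ K * (1 / (2 * R)) ^ n * R ^ n := by gcongr; exact hK n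
      _ = K * (1 / 2) ^ n := by
          rw [mul_assoc, ← mul_pow]; congr 2; field_simp
  have hsum : ∀ t : ℝ, Summable fun n : ℕ => a n * t ^ n := fun t => by
    refine Summable.of_norm_bounded (hs a ha (|t| + 1) (by positivity)) fun n => ?_
    rw [norm_mul, norm_pow, Real.norm_eq_abs, Real.norm_eq_abs]
    gcongr
    linarith
  refine ⟨fun t => ?_, hb, hsum⟩
  have hR : 0 < |t| + 1 := by positivity
  have hS : Summable fun n : ℕ => |a n * n| * (|t| + 1) ^ (n - 1) := by
    rw [← summable_nat_add_iff 1]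
    refine (hs _ hb _ hR).congr fun n => ?_
    push_cast
    rw [mul_comm (a (n + 1))]
  have hd := hasDerivAt_tsum_of_isPreconnected (g := fun n x => a n * x ^ n)
    (g' := fun n x => a n * (n * x ^ (n - 1))) hS (t := Ioo (-(|t| + 1)) (|t| + 1)) isOpen_Ioo
    isPreconnected_Ioo (fun n y _ => (hasDerivAt_pow n y).const_mul (a n))
    (fun n y hy => by
      rw [← mul_assoc, norm_mul, norm_pow, Real.norm_eq_abs, Real.norm_eq_abs]
      gcongr
      exact (abs_lt.2 hy).le)
    (y₀ := t) (y := t) (abs_lt.1 (by linarith)) (hsum t) (abs_lt.1 (by linarith))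
  have hS' : Summable fun n : ℕ => a n * (n * t ^ (n - 1)) := by
    refine Summable.of_norm_bounded hS fun n => ?_
    rw [← mul_assoc, norm_mul, norm_pow, Real.norm_eq_abs, Real.norm_eq_abs]
    gcongr
    linarith
  rw [hS'.tsum_eq_zero_add] at hd
  simp only [Nat.cast_zero, zero_mul, mul_zero, zero_add, Nat.add_sub_cancel] at hd
  refine hd.congr_deriv (tsum_congr fun n => ?_)
  push_cast
  ring

/-- The power series indeed solves the Cauchy problem. -/
theorem isCauchySolution_cauchySol (ω : ℝ) : IsCauchySolution ω (cauchySol ω) := by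
  obtain ⟨h1, hb1, hs0⟩ := hasDerivAt_entire_series (cauchyCoeff ω) (cauchyCoeff_bound ω)
  obtain ⟨h2, hb2, -⟩ := hasDerivAt_entire_series _ hb1
  obtain ⟨-, -, hs2⟩ := hasDerivAt_entire_series _ hb2
  refine ⟨?_, _, _, ?_, fun t _ => ⟨(h1 t).hasDerivWithinAt, (h2 t).hasDerivWithinAt, ?_⟩⟩
  · rw [cauchySol, tsum_eq_single 0 fun n hn => by simp [hn]]
    simp [cauchyCoeff]
  · rw [tsum_eq_single 0 fun n hn => by simp [hn]]
    simp [cauchyCoeff]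
  · suffices h : (∑' n : ℕ, ((n + 1 : ℝ) * (((n + 1 : ℕ) + 1 : ℝ) * cauchyCoeff ω (n + 1 + 1)))
        * t ^ n) = (t ^ 2 + 2 * ω ^ 2) * cauchySol ω t by
      rw [h]; ring
    have e1 := (hs2 t).sum_add_tsum_nat_add 2
    have e2 := (hs0 t).sum_add_tsum_nat_add 2
    have hs0' : Summable fun n : ℕ => cauchyCoeff ω (n + 2) * t ^ (n + 2) :=
      (summable_nat_add_iff 2).2 (hs0 t)
    have e3 : ∀ n : ℕ, (((n + 2 : ℕ) + 1 : ℝ) * (((n + 2 + 1 : ℕ) + 1 : ℝ) *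
        cauchyCoeff ω (n + 2 + 1 + 1))) * t ^ (n + 2) =
        2 * ω ^ 2 * (cauchyCoeff ω (n + 2) * t ^ (n + 2)) +
          t ^ 2 * (cauchyCoeff ω n * t ^ n) := by
      intro n
      rw [show n + 2 + 1 + 1 = n + 4 from rfl, cauchyCoeff]
      push_cast
      field_simp
      ring
    rw [tsum_congr e3, (hs0'.mul_left _).tsum_add ((hs0 t).mul_left _), tsum_mul_left,
      tsum_mul_left] at e1
    simp only [Finset.sum_range_succ, Finset.sum_range_zero, cauchyCoeff, zero_mul] at e1 e2
    rw [← e1]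
    unfold cauchySol
    set S := ∑' n : ℕ, cauchyCoeff ω n * t ^ n
    set S2 := ∑' n : ℕ, cauchyCoeff ω (n + 2) * t ^ (n + 2)
    push_cast
    linear_combination 2 * ω ^ 2 * e2

/-- `G(ω) = ∫₀^∞ u(s, ω)⁻² ds`. -/
noncomputable def oscG (ω : ℝ) : ℝ := ∫ s in Ioi (0 : ℝ), (cauchySol ω s ^ 2)⁻¹

/-- `α_A = arctan G(0)`. -/
noncomputable def alphaA : ℝ := Real.arctan (oscG 0)

/-! For an eigenvalue λ = -ω² ≤ 0 write u for `cauchySol ω`. Its Taylor coefficients are nonnegative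
and only even powers occur, so u ≥ 1 on the whole line. Reduction of order gives a second solution
v(t) = u(t) ∫_t^∞ u⁻², which decays at +∞ and has v(0) = G(ω), v'(0) = -1. An eigenfunction has
constant Wronskians with u and v, hence is a combination of the two. It is square integrable and u
is not, so it is a multiple of v. Thus λ is an eigenvalue of A_{+,θ} exactly when cos θ · G(ω) =
-sin θ, that is, θ = π - arctan G(ω). The potential is even, so reflection gives θ = arctan G(ω) for
A_{-,θ}.

What remains is the behaviour of G: it is positive, continuous and strictly decreasing on [0, ∞),
with G(ω) ≤ π/(2ω), so it maps (0, ∞) onto (0, G(0)) (`oscG_strictAntiOn`, `exists_oscG_eq`). -/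

/-! ### Real solutions, Wronskians and the eigenvalue criterion -/

/-- `u` solves `τ u = l u` on the whole line, with derivative `u'`. -/
structure IsOscSolution (l : ℝ) (u u' : ℝ → ℝ) : Prop where
  hasDerivAt : ∀ t, HasDerivAt u (u' t) t
  hasDerivAt_deriv : ∀ t, HasDerivAt u' ((t ^ 2 - 2 * l) * u t) t

namespace IsOscSolution

variable {l : ℝ} {u u' : ℝ → ℝ}

theorem continuous (h : IsOscSolution l u u') : Continuous u :=
  continuous_iff_continuousAt.2 fun t => (h.hasDerivAt t).continuousAt

theorem continuous_deriv (h : IsOscSolution l u u') : Continuous u' :=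
  continuous_iff_continuousAt.2 fun t => (h.hasDerivAt_deriv t).continuousAt

theorem contDiff_deriv (h : IsOscSolution l u u') : ContDiff ℝ 1 u' := by
  rw [contDiff_one_iff_deriv]
  refine ⟨fun t => (h.hasDerivAt_deriv t).differentiableAt, ?_⟩
  rw [show deriv u' = fun t => (t ^ 2 - 2 * l) * u t from
    funext fun t => (h.hasDerivAt_deriv t).deriv]
  have := h.continuous
  fun_prop

theorem contDiff (h : IsOscSolution l u u') : ContDiff ℝ 1 u := by
  rw [contDiff_one_iff_deriv]
  refine ⟨fun t => (h.hasDerivAt t).differentiableAt, ?_⟩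
  rw [show deriv u = u' from funext fun t => (h.hasDerivAt t).deriv]
  exact h.continuous_deriv

theorem comp_neg (h : IsOscSolution l u u') :
    IsOscSolution l (fun t => u (-t)) (fun t => -u' (-t)) where
  hasDerivAt t := ((h.hasDerivAt (-t)).comp t (hasDerivAt_neg t)).congr_deriv (by simp)
  hasDerivAt_deriv t :=
    ((h.hasDerivAt_deriv (-t)).comp t (hasDerivAt_neg t)).neg.congr_deriv (by simp)

theorem ofReal_deriv (h : IsOscSolution l u u') :
    deriv (fun t => (u t : ℂ)) = fun t => (u' t : ℂ) :=
  funext fun t => (h.hasDerivAt t).ofReal_comp.deriv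

theorem oscExpr_ofReal (h : IsOscSolution l u u') :
    oscExpr (fun t => (u t : ℂ)) = (l : ℂ) • fun t => (u t : ℂ) := by
  ext t
  simp only [oscExpr, h.ofReal_deriv, (h.hasDerivAt_deriv t).ofReal_comp.deriv, Pi.smul_apply,
    smul_eq_mul]
  push_cast
  ring

theorem inMaxDomain (h : IsOscSolution l u u') {I : Set ℝ}
    (hL : MemLp u 2 (volume.restrict I)) : InMaxDomain I (fun t => (u t : ℂ)) where
  differentiableOn := fun t _ =>
    (h.hasDerivAt t).ofReal_comp.differentiableAt.differentiableWithinAt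
  absCont := fun a b _ => (Complex.ofRealCLM.contDiff.comp
    h.contDiff).contDiffOn.absolutelyContinuousOnInterval
  absCont_deriv := by
    rw [h.ofReal_deriv]
    exact fun a b _ => (Complex.ofRealCLM.contDiff.comp
      h.contDiff_deriv).contDiffOn.absolutelyContinuousOnInterval
  memLp := hL.ofReal
  memLp_oscExpr := by
    rw [h.oscExpr_ofReal]
    exact hL.ofReal.const_smul (l : ℂ)

/-- The Wronskian of a smooth real solution and an eigenfunction is constant. -/
theorem exists_wronskian_eq (h : IsOscSolution l u u') {I : Set ℝ} (hI : IsOpen I)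
    (hc : I.OrdConnected) {f : ℝ → ℂ} (hf : InMaxDomain I f)
    (hfl : oscExpr f =ᵐ[volume.restrict I] (l : ℂ) • f) :
    ∃ C : ℂ, ∀ t ∈ I, u t • deriv f t - u' t • f t = C := by
  rcases I.eq_empty_or_nonempty with rfl | ⟨a, ha⟩
  · exact ⟨0, by simp⟩
  refine ⟨u a • deriv f a - u' a • f a, fun b hb => ?_⟩
  have hab : uIcc a b ⊆ I := hc.uIcc_subset ha hb
  -- The eigenvalue equation and the differentiability of f' hold only almost everywhere. Absolute
  -- continuity of the Wronskian still makes it constant once its derivative, -2u(τf - lf), vanishes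
  -- almost everywhere.
  have hac : AbsolutelyContinuousOnInterval (u • deriv f - u' • f) a b :=
    (h.contDiff.contDiffOn.absolutelyContinuousOnInterval.smul (hf.absCont_deriv a b hab)).sub
      (h.contDiff_deriv.contDiffOn.absolutelyContinuousOnInterval.smul (hf.absCont a b hab))
  have hd := hf.absCont_deriv.ae_differentiableAt hI hc
  rw [EventuallyEq, ae_restrict_iff' hI.measurableSet] at hfl
  rw [ae_restrict_iff' hI.measurableSet] at hd
  obtain ⟨C, hC⟩ := hac.const_of_ae_hasDerivAt_zero (by
    filter_upwards [hd, hfl] with t h1 h2 ht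
    have e1 := (h1 (hab ht)).hasDerivAt
    have e2 := (hf.differentiableOn.differentiableAt (hI.mem_nhds (hab ht))).hasDerivAt
    have e3 := ((h.hasDerivAt t).smul e1).sub ((h.hasDerivAt_deriv t).smul e2)
    refine e3.congr_deriv ?_
    have e4 := h2 (hab ht)
    simp only [oscExpr, Pi.smul_apply, smul_eq_mul] at e4
    simp only [Complex.real_smul]
    push_cast
    linear_combination (-2 * (u t : ℂ)) * e4)
  exact (hC b right_mem_uIcc).trans (hC a left_mem_uIcc).symm

end IsOscSolution

/-- If the eigenvalue equation on `I` has a solution `v` in `L²` and an independent solution `u`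
bounded below by `1`, then the eigenvalue condition is the boundary condition for `v`. -/
theorem isEigenvalue_oscOp_iff_boundary {I : Set ℝ} (hI : IsOpen I) (hc : I.OrdConnected)
    (h0 : (𝓝[I] (0 : ℝ)).NeBot) (hvol : volume I = ⊤) {l w : ℝ} {u u' v v' : ℝ → ℝ}
    (hu : IsOscSolution l u u') (hv : IsOscSolution l v v')
    (hW : ∀ t, u t * v' t - u' t * v t = w) (hw : w ≠ 0) (hu1 : ∀ t, 1 ≤ u t)
    (hvL : MemLp v 2 (volume.restrict I)) (θ : ℝ) :
    IsEigenvalue (oscOp I hI hc θ) (l : ℂ) ↔ Real.cos θ * v 0 = Real.sin θ * v' 0 := by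
  rw [isEigenvalue_oscOp_iff]
  have lim : ∀ {g : ℝ → ℝ}, Continuous g →
      Tendsto (fun t => (g t : ℂ)) (𝓝[I] 0) (𝓝 (g 0 : ℂ)) := fun hg =>
    ((Complex.continuous_ofReal.comp hg).tendsto 0).mono_left nhdsWithin_le_nhds
  constructor
  · rintro ⟨f, hf, ⟨a, b, ha, hb, hab⟩, hne, hfl⟩
    obtain ⟨B, hB⟩ := hu.exists_wronskian_eq hI hc hf hfl
    obtain ⟨A, hA⟩ := hv.exists_wronskian_eq hI hc hf hfl
    have hwC : (w : ℂ) ≠ 0 := Complex.ofReal_ne_zero.2 hw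
    have hWC : ∀ t, (u t : ℂ) * v' t - u' t * v t = w := fun t => by exact_mod_cast hW t
    -- Cramer's rule: f and f' are recovered from the constant Wronskians B with u and A with v.
    have hfeq : ∀ t ∈ I, (w : ℂ) * f t = B * v t - A * u t := by
      intro t ht
      rw [← hB t ht, ← hA t ht, ← hWC t]
      simp only [Complex.real_smul]
      ring
    have hf'eq : ∀ t ∈ I, (w : ℂ) * deriv f t = B * v' t - A * u' t := by
      intro t ht
      rw [← hB t ht, ← hA t ht, ← hWC t]
      simp only [Complex.real_smul]
      ring
    -- Otherwise A u = B v - w f is square integrable, and so is the constant A, since u ≥ 1. On a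
    -- set of infinite measure this forces A = 0.
    have hA0 : A = 0 := by
      by_contra hA0
      have hAu : MemLp (fun t => A * (u t : ℂ)) 2 (volume.restrict I) := by
        refine ((hvL.ofReal (K := ℂ)).const_mul B |>.sub (hf.memLp.const_mul (w : ℂ))).ae_eq ?_
        filter_upwards [ae_restrict_mem hI.measurableSet] with t ht
        have := hfeq t ht
        simp only [Pi.sub_apply]
        rw [this]
        simp
      have hcst : MemLp (fun _ : ℝ => A) 2 (volume.restrict I) := by
        refine hAu.mono aestronglyMeasurable_const (Eventually.of_forall fun t => ?_)
        rw [norm_mul, Complex.norm_real, Real.norm_eq_abs]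
        exact le_mul_of_one_le_right (norm_nonneg _) ((hu1 t).trans (le_abs_self _))
      rw [memLp_const_iff (by simp) (by simp)] at hcst
      simp [hA0, hvol] at hcst
    subst hA0
    have hB0 : B ≠ 0 := by
      rintro rfl
      apply hne
      filter_upwards [ae_restrict_mem hI.measurableSet] with t ht
      simpa [hwC] using hfeq t ht
    have e1 : (w : ℂ) * a = B * v 0 := by
      refine tendsto_nhds_unique (ha.const_mul (w : ℂ))
        (((lim hv.continuous).const_mul B).congr' ?_)
      filter_upwards [self_mem_nhdsWithin] with t ht
      simpa using (hfeq t ht).symm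
    have e2 : (w : ℂ) * b = B * v' 0 := by
      refine tendsto_nhds_unique (hb.const_mul (w : ℂ))
        (((lim hv.continuous_deriv).const_mul B).congr' ?_)
      filter_upwards [self_mem_nhdsWithin] with t ht
      simpa using (hf'eq t ht).symm
    have e3 : (Real.cos θ : ℂ) * v 0 = Real.sin θ * v' 0 := by
      refine mul_left_cancel₀ hB0 ?_
      linear_combination (w : ℂ) * hab - (Real.cos θ : ℂ) * e1 + (Real.sin θ : ℂ) * e2
    exact_mod_cast e3
  · intro hb
    refine ⟨fun t => (v t : ℂ), hv.inMaxDomain hvL,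
      ⟨v 0, v' 0, lim hv.continuous, ?_, by exact_mod_cast hb⟩, fun hz => hw ?_, ?_⟩
    · rw [hv.ofReal_deriv]
      exact lim hv.continuous_deriv
    -- If v vanished almost everywhere, then v = v' = 0 at a point of I, against w ≠ 0.
    · have hz' : EqOn (fun t => (v t : ℂ)) (fun _ => 0) I :=
        Measure.eqOn_open_of_ae_eq hz hI
          (Complex.continuous_ofReal.comp hv.continuous).continuousOn continuousOn_const
      have hd := eqOn_deriv_of_eqOn hI hz'
      obtain ⟨t, ht⟩ : I.Nonempty := nonempty_iff_ne_empty.2 fun h => by simp [h] at hvol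
      have e1 : v t = 0 := by simpa using hz' ht
      have e2 : v' t = 0 := by simpa [hv.ofReal_deriv] using hd ht
      rw [← hW t, e1, e2]
      simp
    · rw [hv.oscExpr_ofReal]

/-! ### Positivity and monotonicity of the power series -/

theorem cauchyCoeff_nonneg (ω : ℝ) (n : ℕ) : 0 ≤ cauchyCoeff ω n := by
  induction n using cauchyCoeff.induct with
  | case1 => simp [cauchyCoeff]
  | case2 => simp [cauchyCoeff]
  | case3 => simp only [cauchyCoeff]; positivity
  | case4 => simp [cauchyCoeff]
  | case5 n h1 h2 => rw [cauchyCoeff]; positivity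

theorem cauchyCoeff_odd (ω : ℝ) (n : ℕ) (hn : Odd n) : cauchyCoeff ω n = 0 := by
  induction n using cauchyCoeff.induct with
  | case1 => simp at hn
  | case2 => simp [cauchyCoeff]
  | case3 => exact absurd hn (by decide)
  | case4 => simp [cauchyCoeff]
  | case5 n h1 h2 =>
    rw [cauchyCoeff, h1 (by grind), h2 (by grind)]
    simp

theorem cauchyCoeff_mono {ω R : ℝ} (h : ω ^ 2 ≤ R ^ 2) (n : ℕ) :
    cauchyCoeff ω n ≤ cauchyCoeff R n := by
  induction n using cauchyCoeff.induct with
  | case1 => simp [cauchyCoeff]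
  | case2 => simp [cauchyCoeff]
  | case3 => simpa [cauchyCoeff] using h
  | case4 => simp [cauchyCoeff]
  | case5 n h1 h2 =>
    rw [cauchyCoeff, cauchyCoeff]
    have := cauchyCoeff_nonneg ω (n + 2)
    gcongr

theorem continuous_cauchyCoeff (n : ℕ) : Continuous fun ω => cauchyCoeff ω n := by
  induction n using cauchyCoeff.induct with
  | case1 => simp only [cauchyCoeff]; fun_prop
  | case2 => simp only [cauchyCoeff]; fun_prop
  | case3 => simp only [cauchyCoeff]; fun_prop
  | case4 => simp only [cauchyCoeff]; fun_prop
  | case5 n h1 h2 => simp only [cauchyCoeff]; fun_prop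

theorem cauchyCoeff_mul_pow_nonneg (ω t : ℝ) (n : ℕ) : 0 ≤ cauchyCoeff ω n * t ^ n := by
  rcases n.even_or_odd with hn | hn
  · exact mul_nonneg (cauchyCoeff_nonneg ω n) (hn.pow_nonneg t)
  · simp [cauchyCoeff_odd ω n hn]

theorem summable_cauchyCoeff (ω t : ℝ) : Summable fun n => cauchyCoeff ω n * t ^ n :=
  (hasDerivAt_entire_series _ (cauchyCoeff_bound ω)).2.2 t

/-- All terms are nonnegative, so the series dominates its truncation at degree 4, where the
coefficient is (2ω⁴ + 1)/12. The quadratic term later bounds G for large ω; the quartic one gives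
decay uniform in ω. -/
theorem cauchySol_lower_bound (ω t : ℝ) : 1 + ω ^ 2 * t ^ 2 + t ^ 4 / 12 ≤ cauchySol ω t := by
  have h := (summable_cauchyCoeff ω t).sum_le_tsum (Finset.range 5)
    fun n _ => cauchyCoeff_mul_pow_nonneg ω t n
  simp only [Finset.sum_range_succ, Finset.sum_range_zero, cauchyCoeff] at h
  rw [cauchySol]
  refine le_trans ?_ h
  push_cast
  have : 0 ≤ ω ^ 4 * t ^ 4 := by positivity
  nlinarith

theorem one_le_cauchySol (ω t : ℝ) : 1 ≤ cauchySol ω t := by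
  refine le_trans ?_ (cauchySol_lower_bound ω t)
  have : 0 ≤ ω ^ 2 * t ^ 2 + t ^ 4 / 12 := by positivity
  linarith

theorem cauchySol_pos (ω t : ℝ) : 0 < cauchySol ω t := one_pos.trans_le (one_le_cauchySol ω t)

theorem cauchySol_zero (ω : ℝ) : cauchySol ω 0 = 1 := (isCauchySolution_cauchySol ω).1

theorem cauchySol_monotoneOn (ω : ℝ) : MonotoneOn (cauchySol ω) (Ici 0) := by
  intro s hs t _ hst
  refine (summable_cauchyCoeff ω s).tsum_le_tsum (fun n => ?_) (summable_cauchyCoeff ω t)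
  have := cauchyCoeff_nonneg ω n
  have hs : 0 ≤ s := hs
  gcongr

theorem cauchySol_lt_of_lt {ω R t : ℝ} (h : ω ^ 2 < R ^ 2) (ht : 0 < t) :
    cauchySol ω t < cauchySol R t := by
  refine (summable_cauchyCoeff ω t).tsum_lt_tsum (i := 2) (fun n => ?_) ?_
    (summable_cauchyCoeff R t)
  · have := cauchyCoeff_mono h.le n
    gcongr
  · simp only [cauchyCoeff]
    gcongr

theorem continuous_cauchySol_left (t : ℝ) : Continuous fun ω => cauchySol ω t := by
  rw [continuous_iff_continuousAt]
  intro ω₀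
  -- Weierstrass test near ω₀: coefficients increase with ω², so those at |ω₀| + 1 dominate.
  have h : ContinuousOn (fun ω => cauchySol ω t) (Ioo (-(|ω₀| + 1)) (|ω₀| + 1)) := by
    refine continuousOn_tsum
      (fun n => ((continuous_cauchyCoeff n).mul continuous_const).continuousOn)
      (summable_cauchyCoeff (|ω₀| + 1) |t|) fun n ω hω => ?_
    rw [norm_mul, norm_pow, Real.norm_eq_abs, Real.norm_eq_abs,
      abs_of_nonneg (cauchyCoeff_nonneg ω n)]
    have := cauchyCoeff_mono (sq_le_sq.2 ((abs_lt.2 hω).le.trans (le_abs_self _))) n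
    gcongr
  exact h.continuousAt (isOpen_Ioo.mem_nhds (abs_lt.1 (by linarith)))

/-- The power series solves the differential equation on the whole line. -/
theorem exists_isOscSolution_cauchySol (ω : ℝ) :
    ∃ u', u' 0 = 0 ∧ IsOscSolution (-ω ^ 2) (cauchySol ω) u' := by
  obtain ⟨h1, hb1, hs0⟩ := hasDerivAt_entire_series (cauchyCoeff ω) (cauchyCoeff_bound ω)
  obtain ⟨h2, hb2, -⟩ := hasDerivAt_entire_series _ hb1
  obtain ⟨-, -, hs2⟩ := hasDerivAt_entire_series _ hb2
  refine ⟨_, ?_, h1, fun t => (h2 t).congr_deriv ?_⟩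
  · rw [tsum_eq_single 0 fun n hn => by simp [hn]]
    simp [cauchyCoeff]
  -- The recurrence starts at index 4, so the two lowest terms of u'' and of u are split off and
  -- compared by hand.
  · have e1 := (hs2 t).sum_add_tsum_nat_add 2
    have e2 := (hs0 t).sum_add_tsum_nat_add 2
    have e3 : ∀ n : ℕ, (((n + 2 : ℕ) + 1 : ℝ) * (((n + 2 + 1 : ℕ) + 1 : ℝ) *
        cauchyCoeff ω (n + 2 + 1 + 1))) * t ^ (n + 2) =
        2 * ω ^ 2 * (cauchyCoeff ω (n + 2) * t ^ (n + 2)) +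
          t ^ 2 * (cauchyCoeff ω n * t ^ n) := by
      intro n
      rw [show n + 2 + 1 + 1 = n + 4 from rfl, cauchyCoeff]
      push_cast
      field_simp
      ring
    rw [tsum_congr e3, (((summable_nat_add_iff 2).2 (hs0 t)).mul_left _).tsum_add
      ((hs0 t).mul_left _), tsum_mul_left, tsum_mul_left] at e1
    simp only [Finset.sum_range_succ, Finset.sum_range_zero, cauchyCoeff, zero_mul] at e1 e2
    rw [← e1]
    unfold cauchySol
    push_cast
    linear_combination 2 * ω ^ 2 * e2

theorem continuous_cauchySol (ω : ℝ) : Continuous (cauchySol ω) :=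
  let ⟨_, _, h⟩ := exists_isOscSolution_cauchySol ω
  h.continuous

/-! ### Integrability of u⁻² and the function G -/

theorem continuous_inv_cauchySol_sq (ω : ℝ) : Continuous fun s => (cauchySol ω s ^ 2)⁻¹ :=
  ((continuous_cauchySol ω).pow 2).inv₀ fun s => (pow_pos (cauchySol_pos ω s) 2).ne'

/-- The constant is 24 = 2 · 12, from (1 + s²)² ≤ 2 + 2s⁴ and the term s⁴/12 of the lower bound. -/
theorem inv_cauchySol_le (ω s : ℝ) : (cauchySol ω s)⁻¹ ≤ 24 * ((1 + s ^ 2)⁻¹ * (1 + s ^ 2)⁻¹) := by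
  have h := cauchySol_lower_bound ω s
  rw [← mul_inv, ← div_eq_mul_inv, inv_le_comm₀ (cauchySol_pos ω s) (by positivity), inv_div,
    div_le_iff₀ (by norm_num)]
  nlinarith [sq_nonneg (s ^ 2 - 1), mul_nonneg (sq_nonneg ω) (sq_nonneg s)]

theorem inv_cauchySol_sq_le (ω s : ℝ) : (cauchySol ω s ^ 2)⁻¹ ≤ 24 * (1 + s ^ 2)⁻¹ := by
  have h1 : (cauchySol ω s ^ 2)⁻¹ ≤ (cauchySol ω s)⁻¹ :=
    inv_anti₀ (cauchySol_pos ω s) (le_self_pow₀ (one_le_cauchySol ω s) two_ne_zero)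
  refine (h1.trans (inv_cauchySol_le ω s)).trans ?_
  have h2 : (1 + s ^ 2)⁻¹ ≤ 1 := inv_le_one_of_one_le₀ (by nlinarith [sq_nonneg s])
  gcongr
  exact mul_le_of_le_one_left (by positivity) h2

theorem integrable_inv_cauchySol_sq (ω : ℝ) : Integrable fun s => (cauchySol ω s ^ 2)⁻¹ := by
  refine (integrable_inv_one_add_sq.const_mul 24).mono'
    (continuous_inv_cauchySol_sq ω).aestronglyMeasurable (Eventually.of_forall fun s => ?_)
  rw [Real.norm_of_nonneg (by positivity)]
  exact inv_cauchySol_sq_le ω s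

theorem oscG_pos (ω : ℝ) : 0 < oscG ω := by
  rw [oscG, setIntegral_pos_iff_support_of_nonneg_ae
    (Eventually.of_forall fun s => by simp only [Pi.zero_apply]; positivity)
    (integrable_inv_cauchySol_sq ω).integrableOn]
  rw [show Function.support (fun s => (cauchySol ω s ^ 2)⁻¹) = univ from
    eq_univ_of_forall fun s => (inv_pos.2 (pow_pos (cauchySol_pos ω s) 2)).ne']
  simp

/-- For s > 0 the value u(s, ω) increases strictly with ω², already through the coefficient ω² of
s². -/
theorem oscG_strictAntiOn : StrictAntiOn oscG (Ici 0) := by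
  intro a ha b _ hab
  have ha : 0 ≤ a := ha
  have hlt : ∀ s ∈ Ioi (0 : ℝ), 0 < (cauchySol a s ^ 2)⁻¹ - (cauchySol b s ^ 2)⁻¹ := by
    intro s hs
    have h1 := cauchySol_lt_of_lt (pow_lt_pow_left₀ hab ha two_ne_zero) hs
    have h2 := cauchySol_pos a s
    rw [sub_pos]
    gcongr
  rw [← sub_pos, oscG, oscG, ← integral_sub (integrable_inv_cauchySol_sq a).integrableOn
    (integrable_inv_cauchySol_sq b).integrableOn, setIntegral_pos_iff_support_of_nonneg_ae]
  · rw [inter_eq_right.2 fun s hs => Function.mem_support.2 (hlt s hs).ne']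
    simp
  · filter_upwards [ae_restrict_mem measurableSet_Ioi] with s hs
    exact (hlt s hs).le
  · exact ((integrable_inv_cauchySol_sq a).sub (integrable_inv_cauchySol_sq b)).integrableOn

theorem continuous_oscG : Continuous oscG := by
  refine continuous_of_dominated (bound := fun s => 24 * (1 + s ^ 2)⁻¹)
    (fun ω => (continuous_inv_cauchySol_sq ω).aestronglyMeasurable)
    (fun ω => Eventually.of_forall fun s => ?_)
    (integrable_inv_one_add_sq.const_mul 24).integrableOn
    (Eventually.of_forall fun s => ?_)
  · rw [Real.norm_of_nonneg (by positivity)]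
    exact inv_cauchySol_sq_le ω s
  · exact ((continuous_cauchySol_left s).pow 2).inv₀ fun ω => (pow_pos (cauchySol_pos ω s) 2).ne'

/-- Since u² ≥ u ≥ 1 + (ωs)², the integrand is dominated by a rescaled Cauchy density. -/
theorem oscG_le {ω : ℝ} (hω : 0 < ω) : oscG ω ≤ ω⁻¹ * (Real.pi / 2) := by
  have hi : IntegrableOn (fun s => (1 + (ω * s) ^ 2)⁻¹) (Ioi 0) :=
    (integrable_inv_one_add_sq.comp_mul_left' hω.ne').integrableOn
  have h := integral_comp_mul_left_Ioi (fun x => (1 + x ^ 2)⁻¹) 0 hω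
  rw [mul_zero, integral_Ioi_inv_one_add_sq, Real.arctan_zero, sub_zero, smul_eq_mul] at h
  rw [← h]
  refine setIntegral_mono (integrable_inv_cauchySol_sq ω).integrableOn hi fun s => ?_
  refine inv_anti₀ (by positivity) ?_
  refine le_trans ?_ (le_self_pow₀ (one_le_cauchySol ω s) two_ne_zero)
  refine le_trans ?_ (cauchySol_lower_bound ω s)
  have : 0 ≤ s ^ 4 / 12 := by positivity
  rw [mul_pow]
  linarith

theorem exists_oscG_eq {y : ℝ} (hy : 0 < y) (hy0 : y < oscG 0) : ∃ ω, 0 < ω ∧ oscG ω = y := by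
  -- At this endpoint the bound of `oscG_le` equals y, so the intermediate value theorem applies.
  have hR : 0 < Real.pi / 2 / y := by positivity
  have h1 : oscG (Real.pi / 2 / y) ≤ y := by
    refine (oscG_le hR).trans_eq ?_
    field_simp
  obtain ⟨ω, hω, rfl⟩ := intermediate_value_Icc' hR.le continuous_oscG.continuousOn ⟨h1, hy0.le⟩
  refine ⟨ω, hω.1.lt_of_ne ?_, rfl⟩
  rintro rfl
  exact hy0.false

/-! ### The decaying solution -/

/-- The solution of `τ v = -ω² v` that is square integrable at `+∞`, with `v 0 = G(ω)` and
`v' 0 = -1`. -/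
noncomputable def decayingSol (ω t : ℝ) : ℝ :=
  cauchySol ω t * (oscG ω - ∫ s in (0 : ℝ)..t, (cauchySol ω s ^ 2)⁻¹)

theorem decayingSol_zero (ω : ℝ) : decayingSol ω 0 = oscG ω := by
  simp [decayingSol, cauchySol_zero]

/-- Reduction of order: the bracket J in v = uJ has J' = -u⁻², so v' = u'J - u⁻¹ and the Wronskian
is -u · u⁻¹ = -1. -/
theorem exists_isOscSolution_decayingSol {ω : ℝ} {u' : ℝ → ℝ} (h0 : u' 0 = 0)
    (hu : IsOscSolution (-ω ^ 2) (cauchySol ω) u') :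
    ∃ v', v' 0 = -1 ∧ IsOscSolution (-ω ^ 2) (decayingSol ω) v' ∧
      ∀ t, cauchySol ω t * v' t - u' t * decayingSol ω t = -1 := by
  have hJ : ∀ t, HasDerivAt (fun t => oscG ω - ∫ s in (0 : ℝ)..t, (cauchySol ω s ^ 2)⁻¹)
      (-(cauchySol ω t ^ 2)⁻¹) t := fun t =>
    ((continuous_inv_cauchySol_sq ω).integral_hasStrictDerivAt 0 t).hasDerivAt.const_sub _
  have hne : ∀ t, cauchySol ω t ≠ 0 := fun t => (cauchySol_pos ω t).ne'
  refine ⟨fun t => u' t * (oscG ω - ∫ s in (0 : ℝ)..t, (cauchySol ω s ^ 2)⁻¹) -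
    (cauchySol ω t)⁻¹, by simp [h0, cauchySol_zero], ⟨fun t => ?_, fun t => ?_⟩, fun t => ?_⟩
  · refine ((hu.hasDerivAt t).mul (hJ t)).congr_deriv ?_
    have := hne t
    field_simp
    ring
  · refine (((hu.hasDerivAt_deriv t).mul (hJ t)).sub
      ((hu.hasDerivAt t).inv (hne t))).congr_deriv ?_
    have := hne t
    simp only [decayingSol]
    field_simp
    ring
  · have := hne t
    simp only [decayingSol]
    field_simp
    ring

/-- The bracket is the tail ∫_t^∞ u⁻², and u increases on [0, ∞), so u(t) u(s)⁻² ≤ u(s)⁻¹ for s > t.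
Of the two factors (1 + s²)⁻¹ bounding u(s)⁻¹, one is at most (1 + t²)⁻¹ and the other integrates to
π over the line. -/
theorem abs_decayingSol_le {ω t : ℝ} (ht : 0 < t) :
    |decayingSol ω t| ≤ 24 * Real.pi * (1 + t ^ 2)⁻¹ := by
  have hint := integrable_inv_cauchySol_sq ω
  have hsub : oscG ω - ∫ s in (0 : ℝ)..t, (cauchySol ω s ^ 2)⁻¹ =
      ∫ s in Ioi t, (cauchySol ω s ^ 2)⁻¹ := by
    rw [sub_eq_iff_eq_add', oscG]
    exact (intervalIntegral.integral_interval_add_Ioi hint.integrableOn hint.integrableOn).symm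
  have hle : ∀ s ∈ Ioi t, cauchySol ω t * (cauchySol ω s ^ 2)⁻¹ ≤
      24 * (1 + t ^ 2)⁻¹ * (1 + s ^ 2)⁻¹ := by
    intro s hs
    have hts : t ≤ s := le_of_lt hs
    have h1 := cauchySol_pos ω s
    have h2 : cauchySol ω t ≤ cauchySol ω s :=
      cauchySol_monotoneOn ω ht.le (ht.le.trans hts) hts
    calc cauchySol ω t * (cauchySol ω s ^ 2)⁻¹
        ≤ cauchySol ω s * (cauchySol ω s ^ 2)⁻¹ := by gcongr
      _ = (cauchySol ω s)⁻¹ := by field_simp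
      _ ≤ 24 * ((1 + s ^ 2)⁻¹ * (1 + s ^ 2)⁻¹) := inv_cauchySol_le ω s
      _ ≤ 24 * ((1 + t ^ 2)⁻¹ * (1 + s ^ 2)⁻¹) := by gcongr
      _ = 24 * (1 + t ^ 2)⁻¹ * (1 + s ^ 2)⁻¹ := by ring
  have h0 : 0 ≤ decayingSol ω t := by
    rw [decayingSol, hsub]
    exact mul_nonneg (cauchySol_pos ω t).le (integral_nonneg fun s => by positivity)
  rw [abs_of_nonneg h0, decayingSol, hsub, ← integral_const_mul]
  calc ∫ s in Ioi t, cauchySol ω t * (cauchySol ω s ^ 2)⁻¹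
      ≤ ∫ s in Ioi t, 24 * (1 + t ^ 2)⁻¹ * (1 + s ^ 2)⁻¹ :=
        setIntegral_mono_on (hint.const_mul _).integrableOn
          (integrable_inv_one_add_sq.const_mul _).integrableOn measurableSet_Ioi hle
    _ ≤ ∫ s : ℝ, 24 * (1 + t ^ 2)⁻¹ * (1 + s ^ 2)⁻¹ :=
        setIntegral_le_integral (integrable_inv_one_add_sq.const_mul _)
          (Eventually.of_forall fun s => by simp only [Pi.zero_apply]; positivity)
    _ = 24 * Real.pi * (1 + t ^ 2)⁻¹ := by
        rw [integral_const_mul, integral_univ_inv_one_add_sq]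
        ring

theorem memLp_inv_one_add_sq : MemLp (fun s : ℝ => (1 + s ^ 2)⁻¹) 2 := by
  have hc : Continuous fun s : ℝ => (1 + s ^ 2)⁻¹ :=
    Continuous.inv₀ (by fun_prop) fun s => by positivity
  rw [memLp_two_iff_integrable_sq hc.aestronglyMeasurable]
  refine integrable_inv_one_add_sq.mono' (hc.pow 2).aestronglyMeasurable
    (Eventually.of_forall fun s => ?_)
  rw [Real.norm_of_nonneg (by positivity)]
  exact pow_le_of_le_one (by positivity) (inv_le_one_of_one_le₀ (by nlinarith [sq_nonneg s]))
    two_ne_zero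

theorem memLp_decayingSol {ω : ℝ} (hc : Continuous (decayingSol ω)) :
    MemLp (decayingSol ω) 2 (volume.restrict (Ioi 0)) := by
  refine ((memLp_inv_one_add_sq.const_mul (24 * Real.pi)).restrict (Ioi 0)).mono
    hc.aestronglyMeasurable ?_
  filter_upwards [ae_restrict_mem measurableSet_Ioi] with t ht
  exact (abs_decayingSol_le ht).trans (le_abs_self _)

theorem memLp_decayingSol_neg {ω : ℝ} (hc : Continuous (decayingSol ω)) :
    MemLp (fun t => decayingSol ω (-t)) 2 (volume.restrict (Iio 0)) := by
  refine ((memLp_inv_one_add_sq.const_mul (24 * Real.pi)).restrict (Iio 0)).mono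
    (hc.comp continuous_neg).aestronglyMeasurable ?_
  filter_upwards [ae_restrict_mem measurableSet_Iio] with t ht
  have h := abs_decayingSol_le (ω := ω) (neg_pos.2 ht)
  rw [neg_sq] at h
  exact h.trans (le_abs_self _)

/-! ### From eigenvalues to boundary angles -/

theorem isEigenvalue_oscPlus_iff (ω θ : ℝ) :
    IsEigenvalue (oscPlus θ) ((-ω ^ 2 : ℝ) : ℂ) ↔
      Real.cos θ * oscG ω = -Real.sin θ := by
  obtain ⟨u', hu0, hu⟩ := exists_isOscSolution_cauchySol ω
  obtain ⟨v', hv0, hv, hW⟩ := exists_isOscSolution_decayingSol hu0 hu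
  rw [oscPlus, isEigenvalue_oscOp_iff_boundary isOpen_Ioi ordConnected_Ioi inferInstance
    (by simp) hu hv hW (by norm_num) (one_le_cauchySol ω) (memLp_decayingSol hv.continuous),
    decayingSol_zero, hv0, mul_neg_one]

theorem isEigenvalue_oscMinus_iff (ω θ : ℝ) :
    IsEigenvalue (oscMinus θ) ((-ω ^ 2 : ℝ) : ℂ) ↔
      Real.cos θ * oscG ω = Real.sin θ := by
  obtain ⟨u', hu0, hu⟩ := exists_isOscSolution_cauchySol ω
  obtain ⟨v', hv0, hv, hW⟩ := exists_isOscSolution_decayingSol hu0 hu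
  -- Reflection flips the sign of the Wronskian and of v'(0), hence `w := 1` and the changed sign of
  -- sin θ.
  rw [oscMinus, isEigenvalue_oscOp_iff_boundary isOpen_Iio ordConnected_Iio inferInstance
    (by simp) hu.comp_neg hv.comp_neg (w := 1) (fun t => by linear_combination -hW (-t))
    one_ne_zero (fun t => one_le_cauchySol ω (-t)) (memLp_decayingSol_neg hv.continuous),
    neg_zero, decayingSol_zero, hv0, neg_neg, mul_one]

/-- As sin θ ≥ 0 and g > 0, cos θ ≥ 0; if cos θ = 0, then sin θ = 0 too, which is impossible. So θ <
π/2 and tan θ = g can be inverted. -/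
theorem cos_mul_eq_sin_iff {g θ : ℝ} (hg : 0 < g) (hθ : θ ∈ Ico 0 Real.pi) :
    Real.cos θ * g = Real.sin θ ↔ θ = Real.arctan g := by
  constructor
  · intro h
    have hs : 0 ≤ Real.sin θ := Real.sin_nonneg_of_nonneg_of_le_pi hθ.1 hθ.2.le
    have hc : 0 < Real.cos θ := by
      refine (nonneg_of_mul_nonneg_left (h ▸ hs) hg).lt_of_ne' fun hc => ?_
      have h1 := Real.sin_sq_add_cos_sq θ
      rw [← h, hc] at h1
      norm_num at h1
    have hlt : θ < Real.pi / 2 := by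
      by_contra! hge
      exact hc.not_ge (Real.cos_nonpos_of_pi_div_two_le_of_le hge (by linarith [hθ.2, hθ.1]))
    rw [← Real.arctan_tan (by linarith [hθ.1, Real.pi_pos]) hlt, Real.tan_eq_sin_div_cos, ← h,
      mul_div_cancel_left₀ _ hc.ne']
  · rintro rfl
    have h := Real.tan_arctan g
    rw [Real.tan_eq_sin_div_cos, div_eq_iff (Real.cos_arctan_pos g).ne'] at h
    rw [h, mul_comm]

theorem cos_mul_eq_neg_sin_iff {g θ : ℝ} (hg : 0 < g) (hθ : θ ∈ Ico 0 Real.pi) :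
    Real.cos θ * g = -Real.sin θ ↔ θ = Real.pi - Real.arctan g := by
  -- The substitution π - θ leaves [0, π) when θ = 0, a case where both sides are false.
  rcases hθ.1.eq_or_lt with rfl | h0
  · have := Real.arctan_lt_pi_div_two g
    have h1 : (0 : ℝ) ≠ Real.pi - Real.arctan g := by linarith [Real.pi_pos]
    simp [hg.ne', h1]
  · have h := cos_mul_eq_sin_iff (θ := Real.pi - θ) hg ⟨by linarith [hθ.2], by linarith⟩
    rw [Real.cos_pi_sub, Real.sin_pi_sub, neg_mul, neg_eq_iff_eq_neg] at h
    rw [h]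
    constructor <;> intro h <;> linarith

theorem isEigenvalue_oscPlus_iff_eq {l θ : ℝ} (hl : l ≤ 0) (hθ : θ ∈ Ico 0 Real.pi) :
    IsEigenvalue (oscPlus θ) (l : ℂ) ↔ θ = Real.pi - Real.arctan (oscG (√(-l))) := by
  rw [← cos_mul_eq_neg_sin_iff (oscG_pos _) hθ, ← isEigenvalue_oscPlus_iff,
    Real.sq_sqrt (by linarith), neg_neg]

theorem isEigenvalue_oscMinus_iff_eq {l θ : ℝ} (hl : l ≤ 0) (hθ : θ ∈ Ico 0 Real.pi) :
    IsEigenvalue (oscMinus θ) (l : ℂ) ↔ θ = Real.arctan (oscG (√(-l))) := by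
  rw [← cos_mul_eq_sin_iff (oscG_pos _) hθ, ← isEigenvalue_oscMinus_iff,
    Real.sq_sqrt (by linarith), neg_neg]

theorem arctan_oscG_sqrt_lt {l₁ l₂ : ℝ} (h : l₂ < l₁) (h1 : l₁ ≤ 0) :
    Real.arctan (oscG (√(-l₂))) < Real.arctan (oscG (√(-l₁))) :=
  Real.arctan_lt_arctan_iff.2 (oscG_strictAntiOn (Real.sqrt_nonneg _) (Real.sqrt_nonneg _)
    (Real.sqrt_lt_sqrt (by linarith) (by linarith)))

theorem arctan_oscG_sqrt_lt_alphaA {l : ℝ} (h : l < 0) :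
    Real.arctan (oscG (√(-l))) < alphaA := by
  simpa [alphaA] using arctan_oscG_sqrt_lt h le_rfl

theorem exists_arctan_oscG_sqrt_eq {φ : ℝ} (hφ : φ ∈ Ioo 0 alphaA) :
    ∃ l < 0, φ = Real.arctan (oscG (√(-l))) := by
  have h2 : φ < Real.pi / 2 := hφ.2.trans (Real.arctan_lt_pi_div_two _)
  have h1 : -(Real.pi / 2) < φ := by linarith [hφ.1, Real.pi_pos]
  -- ω solves G(ω) = tan φ, which lies in (0, G(0)) because φ < arctan G(0).
  obtain ⟨ω, hω, h⟩ := exists_oscG_eq (Real.tan_pos_of_pos_of_lt_pi_div_two hφ.1 h2) (by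
    rw [← Real.arctan_lt_arctan_iff, Real.arctan_tan h1 h2]
    exact hφ.2)
  refine ⟨-ω ^ 2, by simpa using pow_pos hω 2, ?_⟩
  rw [neg_neg, Real.sqrt_sq hω.le, h, Real.arctan_tan h1 h2]

theorem lemma2p4 :
    ((∀ θ ∈ Ico (0 : ℝ) Real.pi,
        (IsEigenvalue (oscPlus θ) 0 ↔ θ = Real.pi - alphaA) ∧
        ((∃ l : ℝ, l < 0 ∧ IsEigenvalue (oscPlus θ) (l : ℂ)) ↔
          θ ∈ Ioo (Real.pi - alphaA) Real.pi)) ∧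
      (∀ θ₁ ∈ Ico (0 : ℝ) Real.pi, ∀ θ₂ ∈ Ico (0 : ℝ) Real.pi, ∀ l₁ l₂ : ℝ,
        IsEigenvalue (oscPlus θ₁) (l₁ : ℂ) → IsEigenvalue (oscPlus θ₂) (l₂ : ℂ) →
        l₂ < l₁ → l₁ < 0 →
          Real.pi - alphaA < θ₁ ∧ θ₁ < θ₂ ∧ θ₂ < Real.pi)) ∧
    ((∀ θ ∈ Ico (0 : ℝ) Real.pi,
        (IsEigenvalue (oscMinus θ) 0 ↔ θ = alphaA) ∧
        ((∃ l : ℝ, l < 0 ∧ IsEigenvalue (oscMinus θ) (l : ℂ)) ↔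
          θ ∈ Ioo (0 : ℝ) alphaA)) ∧
      (∀ θ₁ ∈ Ico (0 : ℝ) Real.pi, ∀ θ₂ ∈ Ico (0 : ℝ) Real.pi, ∀ l₁ l₂ : ℝ,
        IsEigenvalue (oscMinus θ₁) (l₁ : ℂ) → IsEigenvalue (oscMinus θ₂) (l₂ : ℂ) →
        l₂ < l₁ → l₁ < 0 →
          θ₁ < alphaA ∧ θ₂ < θ₁ ∧ 0 < θ₂)) := by
  have hpos : ∀ l : ℝ, 0 < Real.arctan (oscG (√(-l))) := fun l =>
    Real.arctan_pos.2 (oscG_pos _)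
  refine ⟨⟨fun θ hθ => ⟨?_, ?_, fun h => ?_⟩, fun θ₁ h₁ θ₂ h₂ l₁ l₂ e₁ e₂ hl hl₁ => ?_⟩,
    ⟨fun θ hθ => ⟨?_, ?_, fun h => ?_⟩, fun θ₁ h₁ θ₂ h₂ l₁ l₂ e₁ e₂ hl hl₁ => ?_⟩⟩
  · simpa [alphaA] using isEigenvalue_oscPlus_iff_eq le_rfl hθ
  · rintro ⟨l, hl, h⟩
    rw [isEigenvalue_oscPlus_iff_eq hl.le hθ] at h
    exact ⟨by linarith [arctan_oscG_sqrt_lt_alphaA hl], hθ.2⟩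
  · obtain ⟨l, hl, e⟩ := exists_arctan_oscG_sqrt_eq (φ := Real.pi - θ)
      ⟨by linarith [h.2], by linarith [h.1]⟩
    exact ⟨l, hl, (isEigenvalue_oscPlus_iff_eq hl.le hθ).2 (by linarith)⟩
  · rw [isEigenvalue_oscPlus_iff_eq hl₁.le h₁] at e₁
    rw [isEigenvalue_oscPlus_iff_eq (hl.trans hl₁).le h₂] at e₂
    have := arctan_oscG_sqrt_lt hl hl₁.le
    have := arctan_oscG_sqrt_lt_alphaA hl₁
    exact ⟨by linarith, by linarith, h₂.2⟩
  · simpa [alphaA] using isEigenvalue_oscMinus_iff_eq le_rfl hθ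
  · rintro ⟨l, hl, h⟩
    rw [isEigenvalue_oscMinus_iff_eq hl.le hθ] at h
    exact ⟨h ▸ hpos l, h ▸ arctan_oscG_sqrt_lt_alphaA hl⟩
  · obtain ⟨l, hl, e⟩ := exists_arctan_oscG_sqrt_eq h
    exact ⟨l, hl, (isEigenvalue_oscMinus_iff_eq hl.le hθ).2 e⟩
  · rw [isEigenvalue_oscMinus_iff_eq hl₁.le h₁] at e₁
    rw [isEigenvalue_oscMinus_iff_eq (hl.trans hl₁).le h₂] at e₂
    exact ⟨e₁ ▸ arctan_oscG_sqrt_lt_alphaA hl₁, by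
      rw [e₁, e₂]; exact arctan_oscG_sqrt_lt hl hl₁.le, e₂ ▸ hpos l₂⟩
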